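/- **Model.** Two sellers $i=1,2$ with zero marginal cost set prices $p_1,p_2$, which consumers observe. A unit mass of consumers demands one unit each; a consumer's match utilities $u_1,u_2$ are independent and uniform on $[0,1]$, and $u_i$ is learned by inspecting seller $i$. The first inspection is free, the second costs $s\ge 0$, recall is free, and the outside option is worth $0$. Let $V(p)=\mathbb E[\max\{0,u-p\}]$ for $u$ uniform on $[0,1]$, and let $A\le 1$ be given by $V(A)=s$. A consumer who has inspected seller $i$ first goes on to inspect seller $j$ unless $V(p_j+\max\{0,u_i-p_i\})<s$, and then takes the best of the inspected products (payoff $u_k-p_k$) and the outside option. Let $D_i^n(p_1,p_2)$ be the resulting demand of seller $i$ when ranked $n$-th, and $\pi_i^n=p_iD_i^n$. A contract $(p_1,p_2,\alpha)$ with $\alpha\in[0,1]$ recommends the prices $p_1,p_2$ and has seller 1 inspected first with probability $\alpha$; a seller who deviates in price is ranked second with probability one. Accepted, it gives the profits $\Pi_1=\alpha\pi_1^1+(1-\alpha)\pi_1^2$ and $\Pi_2=\alpha\pi_2^2+(1-\alpha)\pi_2^1$. It is implementable if $\max_{p_1'}\pi_1^2(p_1',p_2)\le\Pi_1$ and $\max_{p_2'}\pi_2^2(p_1,p_2')\le\Pi_2$.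 Let $P_s$ be the set of price vectors $(p_1,p_2)$ for which some contract $(p_1,p_2,\alpha)$ is implementable. Industry profit is $\Pi_1+\Pi_2$; social welfare is the expected match utility of the purchased product (zero if none) minus the expected search cost; consumer surplus is the expected value of $u_k-p_k$ for the purchased product $k$ (zero if none) minus the expected search cost. **Proposition.** There is $A_0<1$ such that for every $A\in[A_0,1]$, with $s=V(A)$, the following holds. There are $\underline p\le\bar p$ with $$\{p:(p,p)\in\partial P_s\}=\{\underline p,\bar p\},$$ $\underline p$ is the smallest $p$ with $(p,p)\in P_s$, and the random-search contract $(\underline p,\underline p,\tfrac12)$ is implementable. Among all implementable contracts it minimizes industry profit, maximizes social welfare, and maximizes consumer surplus. -/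

import Mathlib

open MeasureTheory

/-! Sequential search with two sellers and free first search.  In all functions of one consumer's
visit, `p` is the price of the seller inspected first and `q` the price of the other one, `u` and `v`
are the corresponding match utilities, and `s` is the search cost. -/

/-- The law of a match utility: uniform on `[0, 1]`. -/
noncomputable def matchLaw : Measure ℝ := volume.restrict (Set.Icc 0 1)

/-- The joint law of the two independent match utilities. -/
noncomputable def matchPairLaw : Measure (ℝ × ℝ) := matchLaw.prod matchLaw

/-- `V(p) = E[max {0, u - p}]`. -/
noncomputable def expectedSurplus (p : ℝ) : ℝ := ∫ u, max 0 (u - p) ∂matchLaw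

/-- The optimal stopping rule: after the first inspection the consumer has `x = max {0, u - p}` in
hand, and inspects the second seller unless the expected gain `E[max {0, v - q - x}]` is smaller
than the search cost. -/
def Searches (s p q u : ℝ) : Prop := s ≤ expectedSurplus (q + max 0 (u - p))

/-- The consumer buys from the seller inspected first (immediately or by free recall). -/
def BuysFirst (s p q u v : ℝ) : Prop := p ≤ u ∧ (Searches s p q u → v - q ≤ u - p)

/-- The consumer buys from the seller inspected second. -/
def BuysSecond (s p q u v : ℝ) : Prop := Searches s p q u ∧ q ≤ v ∧ u - p < v - q

/-- Demand of the seller inspected first, with price `p`, against the price `q`. -/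
noncomputable def demandFirst (s p q : ℝ) : ℝ :=
  matchPairLaw.real {z | BuysFirst s p q z.1 z.2}

/-- Demand of the seller inspected second, with price `q`, if the first one has price `p`. -/
noncomputable def demandSecond (s p q : ℝ) : ℝ :=
  matchPairLaw.real {z | BuysSecond s p q z.1 z.2}

open Classical in
/-- Expected match value of the purchase, net of search costs. -/
noncomputable def orderedWelfare (s p q : ℝ) : ℝ :=
  ∫ z, ((if BuysFirst s p q z.1 z.2 then z.1 else if BuysSecond s p q z.1 z.2 then z.2 else 0)
    - (if Searches s p q z.1 then s else 0)) ∂matchPairLaw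

open Classical in
/-- Expected consumer payoff: match value minus price of the purchase, net of search costs. -/
noncomputable def orderedSurplus (s p q : ℝ) : ℝ :=
  ∫ z, ((if BuysFirst s p q z.1 z.2 then z.1 - p
      else if BuysSecond s p q z.1 z.2 then z.2 - q else 0)
    - (if Searches s p q z.1 then s else 0)) ∂matchPairLaw

/-- A contract `(p₁, p₂, α)`: recommended prices, and the probability that seller 1 is inspected
first if both sellers follow the recommendation. -/
abbrev Contract := ℝ × ℝ × ℝ

/-- Profit of seller 1 under a contract that both sellers accept. -/
noncomputable def profitOne (s : ℝ) : Contract → ℝ := fun (p₁, p₂, α) =>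
  α * (p₁ * demandFirst s p₁ p₂) + (1 - α) * (p₁ * demandSecond s p₂ p₁)

/-- Profit of seller 2 under a contract that both sellers accept. -/
noncomputable def profitTwo (s : ℝ) : Contract → ℝ := fun (p₁, p₂, α) =>
  α * (p₂ * demandSecond s p₁ p₂) + (1 - α) * (p₂ * demandFirst s p₂ p₁)

/-- The contracts that satisfy both incentive constraints: a seller who deviates in price is
inspected second with probability one, and no such deviation is profitable. -/
def implementableContracts (s : ℝ) : Set Contract :=
  {(p₁, p₂, α) : Contract | α ∈ Set.Icc (0 : ℝ) 1 ∧
    (∀ p' : ℝ, p' * demandSecond s p₂ p' ≤ profitOne s (p₁, p₂, α)) ∧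
    (∀ p' : ℝ, p' * demandSecond s p₁ p' ≤ profitTwo s (p₁, p₂, α))}

/-- The set `P` of implementable price vectors. -/
def implementablePrices (s : ℝ) : Set (ℝ × ℝ) :=
  {(p₁, p₂) : ℝ × ℝ | ∃ α : ℝ, (p₁, p₂, α) ∈ implementableContracts s}

noncomputable def industryProfit (s : ℝ) : Contract → ℝ := fun c => profitOne s c + profitTwo s c

noncomputable def socialWelfare (s : ℝ) : Contract → ℝ := fun (p₁, p₂, α) =>
  α * orderedWelfare s p₁ p₂ + (1 - α) * orderedWelfare s p₂ p₁

noncomputable def consumerSurplus (s : ℝ) : Contract → ℝ := fun (p₁, p₂, α) =>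
  α * orderedSurplus s p₁ p₂ + (1 - α) * orderedSurplus s p₂ p₁

/-!
The proof works with explicit demands. Put `e = 1 - A`, so `s = e ^ 2 / 2`. For prices in `[0, A]` a
pair `(p, q)` sells `1 - p * q` in total, whatever the order of inspection, and a second-ranked
seller with price `t` against `q` earns `t * (q * (1 - t) + (1 - t) ^ 2 / 2 - s)` as long as
`q - e ≤ t`, and no more than that if it undercuts further. This expression, `secondProfit s q t`,
is affine in `q`.

*Diagonal.* By symmetry `(p, p)` is implementable iff no deviation earns more than half of the
industry profit, `p * (1 - p ^ 2) / 2`; the deviations can be evaluated by `secondProfit`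
(`mem_diagonalPrices_iff`). The set of these `p` is compact and contains the equilibrium price of
the market without contracts. Strictly between two of its elements the incentive constraints are
slack, as `p * (1 - p ^ 2) / 2` is strictly concave and `secondProfit` is affine in `p`
(`exists_slack`), and then small price changes in any direction keep `α = 1 / 2` implementable. A
deviation that rules out `(p, p)` rules out a neighbourhood. Hence the boundary meets the diagonal
in the two extreme elements only.

*Extremality.* Let `c` be the smallest element and `r` the deviation that is exactly as good as
compliance there. If `(a, b, α)` is implementable, both sellers earn at least what `r` gives them.
Unless both prices are at least `c`, neither exceeds `r + e` (`price_le_of_lt`), so these guarantees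
are affine functions of the rival's price. They add up, as total demand is `1 - a * b`, to an
inequality that the mean price inherits, and this puts the mean price at `c` or above
(`le_average_of_sum_le`). So industry profit, which is at least the sum of the guarantees, is
smallest at `(c, c)` (`implementable_bounds`).

*Welfare.* Given who buys nothing, welfare is at most that of unbiased searches and choices,
`2 / 3 - s - (p ^ 3 + 3 * p * q ^ 2) / 6 + e ^ 3 / 3`, minus a loss from the bias if the second
product is dearer (`orderedWelfare_le`). With both prices at least `c`, or with moderate prices of
mean at least `c`, this is at most the value at `(c, c)`. Consumer surplus is welfare minus industry
profit, so it is maximal there, too.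
-/

/-! ### Match utilities, the stopping rule and payoffs -/

lemma integral_matchLaw (f : ℝ → ℝ) : ∫ u, f u ∂matchLaw = ∫ u in (0 : ℝ)..1, f u := by
  rw [matchLaw, integral_Icc_eq_integral_Ioc, intervalIntegral.integral_of_le zero_le_one]

instance : IsProbabilityMeasure matchLaw := ⟨by simp [matchLaw]⟩

instance : IsProbabilityMeasure matchPairLaw := by
  unfold matchPairLaw; infer_instance

lemma matchPairLaw_eq :
    matchPairLaw = volume.restrict (Set.Icc (0 : ℝ) 1 ×ˢ Set.Icc (0 : ℝ) 1) := by
  rw [matchPairLaw, matchLaw, Measure.prod_restrict]; rfl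

lemma ae_matchPairLaw :
    ∀ᵐ z ∂matchPairLaw, z.1 ∈ Set.Icc (0 : ℝ) 1 ∧ z.2 ∈ Set.Icc (0 : ℝ) 1 := by
  rw [matchPairLaw_eq]
  filter_upwards [ae_restrict_mem (measurableSet_Icc.prod measurableSet_Icc)] with z hz
  exact hz

lemma integrable_matchPairLaw {f : ℝ × ℝ → ℝ} (hf : Continuous f) : Integrable f matchPairLaw := by
  rw [matchPairLaw_eq]
  exact hf.continuousOn.integrableOn_compact (isCompact_Icc.prod isCompact_Icc)

lemma integrable_matchLaw {f : ℝ → ℝ} (hf : Continuous f) : Integrable f matchLaw :=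
  hf.continuousOn.integrableOn_compact isCompact_Icc

/-- An interval integral over `[a, c]` only sees the values in the open intervals `(a, b)` and
`(b, c)`; this is how all piecewise integrands below are evaluated. -/
lemma integral_piecewise {f g h : ℝ → ℝ} {a b c : ℝ} (hab : a ≤ b) (hbc : b ≤ c)
    (hg : IntervalIntegrable g volume a b) (hh : IntervalIntegrable h volume b c)
    (hfg : ∀ x, a < x → x < b → f x = g x) (hfh : ∀ x, b < x → x < c → f x = h x) :
    IntervalIntegrable f volume a c ∧
      ∫ x in a..c, f x = (∫ x in a..b, g x) + ∫ x in b..c, h x := by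
  have h1 : ∀ᵐ x ∂volume.restrict (Set.uIoc a b), g x = f x := by
    rw [Set.uIoc_of_le hab, ← restrict_Ioo_eq_restrict_Ioc]
    filter_upwards [ae_restrict_mem measurableSet_Ioo] with x hx
    exact (hfg x hx.1 hx.2).symm
  have h2 : ∀ᵐ x ∂volume.restrict (Set.uIoc b c), h x = f x := by
    rw [Set.uIoc_of_le hbc, ← restrict_Ioo_eq_restrict_Ioc]
    filter_upwards [ae_restrict_mem measurableSet_Ioo] with x hx
    exact (hfh x hx.1 hx.2).symm
  have i1 : IntervalIntegrable f volume a b := hg.congr_ae h1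
  have i2 : IntervalIntegrable f volume b c := hh.congr_ae h2
  refine ⟨i1.trans i2, ?_⟩
  rw [← intervalIntegral.integral_add_adjacent_intervals i1 i2]
  congr 1
  · exact intervalIntegral.integral_congr_ae_restrict (h1.mono fun x hx => hx.symm)
  · exact intervalIntegral.integral_congr_ae_restrict (h2.mono fun x hx => hx.symm)

lemma expectedSurplus_of_mem {p : ℝ} (h0 : 0 ≤ p) (h1 : p ≤ 1) :
    expectedSurplus p = (1 - p) ^ 2 / 2 := by
  have h := (integral_piecewise (f := fun u => max 0 (u - p)) (g := fun _ => 0)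
    (h := fun u => u - p) h0 h1 (by simp) (Continuous.intervalIntegrable (by fun_prop) _ _)
    (fun x _ hx => max_eq_left (by linarith)) (fun x hx _ => max_eq_right (by linarith))).2
  rw [expectedSurplus, integral_matchLaw, h]
  rw [intervalIntegral.integral_sub (by simp) (by simp)]
  simp only [intervalIntegral.integral_zero, integral_id, intervalIntegral.integral_const,
    smul_eq_mul]
  ring

lemma expectedSurplus_antitone : Antitone expectedSurplus := fun p q hpq =>
  integral_mono (integrable_matchLaw (by fun_prop)) (integrable_matchLaw (by fun_prop))
    fun _ => max_le_max le_rfl (by linarith)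

lemma expectedSurplus_nonneg (p : ℝ) : 0 ≤ expectedSurplus p :=
  integral_nonneg fun _ => le_max_left _ _

lemma searches_of_le {A s p q u : ℝ} (hs : expectedSurplus A = s) (h : q + max 0 (u - p) ≤ A) :
    Searches s p q u := by
  rw [Searches, ← hs]; exact expectedSurplus_antitone h

lemma not_searches {A s p q u : ℝ} (hA0 : 0 ≤ A) (hA1 : A < 1) (hs : expectedSurplus A = s)
    (h : A < q + max 0 (u - p)) : ¬ Searches s p q u := by
  rw [Searches, ← hs, not_le, expectedSurplus_of_mem hA0 hA1.le]
  have hm : A < min 1 (q + max 0 (u - p)) := lt_min hA1 h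
  have hm1 := min_le_left 1 (q + max 0 (u - p))
  calc expectedSurplus (q + max 0 (u - p))
      ≤ expectedSurplus (min 1 (q + max 0 (u - p))) := expectedSurplus_antitone (min_le_right _ _)
    _ = (1 - min 1 (q + max 0 (u - p))) ^ 2 / 2 := expectedSurplus_of_mem (by linarith) hm1
    _ < (1 - A) ^ 2 / 2 := by nlinarith

/-- For `A = 1` everybody searches, but consumers with `q + max 0 (u - p) > 1` never buy there. -/
lemma buysSecond_iff {A s p q u v : ℝ} (hA0 : 0 ≤ A) (hA1 : A ≤ 1) (hs : expectedSurplus A = s)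
    (hv : v ≤ 1) : BuysSecond s p q u v ↔
      q + max 0 (u - p) ≤ A ∧ q + max 0 (u - p) ≤ v ∧ u - p < v - q := by
  constructor
  · rintro ⟨h1, h2, h3⟩
    have h4 : q + max 0 (u - p) ≤ v := by
      rcases max_choice 0 (u - p) with h | h <;> rw [h] <;> linarith
    refine ⟨?_, h4, h3⟩
    by_contra! h
    rcases hA1.lt_or_eq with hlt | rfl
    · exact not_searches hA0 hlt hs h h1
    · linarith
  · rintro ⟨h1, h2, h3⟩
    exact ⟨searches_of_le hs h1, by linarith [le_max_left 0 (u - p)], h3⟩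

lemma buysFirst_iff {A s p q u v : ℝ} (hA0 : 0 ≤ A) (hA1 : A ≤ 1) (hs : expectedSurplus A = s)
    (hv : v ≤ 1) : BuysFirst s p q u v ↔ p ≤ u ∧ (q + (u - p) ≤ A → v ≤ q + (u - p)) := by
  constructor
  · rintro ⟨h1, h2⟩
    refine ⟨h1, fun h => ?_⟩
    have := h2 (searches_of_le hs (by rwa [max_eq_right (by linarith)]))
    linarith
  · rintro ⟨h1, h2⟩
    refine ⟨h1, fun h => ?_⟩
    by_cases h3 : q + (u - p) ≤ A
    · linarith [h2 h3]
    · rcases hA1.lt_or_eq with hlt | rfl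
      · exact absurd h (not_searches hA0 hlt hs (by
          rw [max_eq_right (by linarith)]; linarith))
      · linarith

lemma BuysFirst.not_buysSecond {s p q u v : ℝ} (h : BuysFirst s p q u v) :
    ¬ BuysSecond s p q u v := fun h2 => absurd (h.2 h2.1) (not_le.2 h2.2.2)

lemma measurableSet_searches (s p q : ℝ) : MeasurableSet {z : ℝ × ℝ | Searches s p q z.1} :=
  measurableSet_le measurable_const (expectedSurplus_antitone.measurable.comp (by fun_prop))

lemma measurableSet_buysFirst (s p q : ℝ) :
    MeasurableSet {z : ℝ × ℝ | BuysFirst s p q z.1 z.2} :=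
  (measurableSet_le measurable_const measurable_fst).inter
    ((measurableSet_searches s p q).imp
      (measurableSet_le (measurable_snd.sub_const q) (measurable_fst.sub_const p)))

lemma measurableSet_buysSecond (s p q : ℝ) :
    MeasurableSet {z : ℝ × ℝ | BuysSecond s p q z.1 z.2} :=
  (measurableSet_searches s p q).inter
    ((measurableSet_le measurable_const measurable_snd).inter
      (measurableSet_lt (measurable_fst.sub_const p) (measurable_snd.sub_const q)))

/-- The payoff of a visit when a purchase at the first seller is worth `f u`, a purchase at the
second one `g v`, and a search costs `c`. Demands, welfare and consumer surplus are its means. -/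
noncomputable def outcome (s p q : ℝ) (f g : ℝ → ℝ) (c : ℝ) (z : ℝ × ℝ) : ℝ :=
  Set.indicator {z : ℝ × ℝ | BuysFirst s p q z.1 z.2} (fun z => f z.1) z
    + Set.indicator {z : ℝ × ℝ | BuysSecond s p q z.1 z.2} (fun z => g z.2) z
    - Set.indicator {z : ℝ × ℝ | Searches s p q z.1} (fun _ => c) z

lemma integrable_outcome (s p q : ℝ) {f g : ℝ → ℝ} (hf : Continuous f) (hg : Continuous g)
    (c : ℝ) : Integrable (outcome s p q f g c) matchPairLaw :=
  (((integrable_matchPairLaw (by fun_prop)).indicator (measurableSet_buysFirst s p q)).add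
    ((integrable_matchPairLaw (by fun_prop)).indicator (measurableSet_buysSecond s p q))).sub
    ((integrable_const c).indicator (measurableSet_searches s p q))

lemma integral_outcome_eq_iterated (s p q : ℝ) {f g : ℝ → ℝ} (hf : Continuous f)
    (hg : Continuous g) (c : ℝ) :
    ∫ z, outcome s p q f g c z ∂matchPairLaw =
      ∫ u in (0 : ℝ)..1, ∫ v in (0 : ℝ)..1, outcome s p q f g c (u, v) := by
  have h := integrable_outcome s p q hf hg c
  rw [matchPairLaw] at h ⊢
  rw [integral_prod _ h, integral_matchLaw]
  simp only [integral_matchLaw]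

/-! ### The mean payoff of a visit -/

/-- Conditional on `u < p`, the consumer searches and buys if `v > q`. -/
lemma integral_outcome_of_lt {A s p q u : ℝ} (hA1 : A ≤ 1)
    (hs : expectedSurplus A = s) (hq0 : 0 ≤ q) (hqA : q ≤ A) (hu : u < p)
    {f g G : ℝ → ℝ} (hg : Continuous g) (hG : ∀ v, HasDerivAt G (g v) v) (c : ℝ) :
    ∫ v in (0 : ℝ)..1, outcome s p q f g c (u, v) = G 1 - G q - c := by
  have hm : max 0 (u - p) = 0 := max_eq_left (by linarith)
  have hS : Searches s p q u := searches_of_le hs (by rw [hm]; linarith)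
  have h := (integral_piecewise (f := fun v => outcome s p q f g c (u, v)) (g := fun _ => -c)
    (h := fun v => g v - c) hq0 (hqA.trans hA1) (by simp)
    (Continuous.intervalIntegrable (by fun_prop) _ _)
    (fun v _ hv => by simp [outcome, BuysFirst, BuysSecond, hS, hu, hv])
    (fun v hv _ => by
      have : u - p < v - q := by linarith
      simp [outcome, BuysFirst, BuysSecond, hS, hu, hv.le, this])).2
  rw [h, intervalIntegral.integral_sub (hg.intervalIntegrable _ _) (by simp),
    intervalIntegral.integral_eq_sub_of_hasDerivAt (fun v _ => hG v) (hg.intervalIntegrable _ _)]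
  simp only [intervalIntegral.integral_const, smul_eq_mul]
  ring

/-- Conditional on `p < u` with the threshold `q + (u - p)` below `A`, the consumer searches and
buys from the second seller if `v` exceeds that threshold. -/
lemma integral_outcome_of_searches {A s p q u : ℝ} (hA1 : A ≤ 1)
    (hs : expectedSurplus A = s) (hq0 : 0 ≤ q) (hu : p < u) (huA : q + (u - p) ≤ A)
    {f g G : ℝ → ℝ} (hg : Continuous g) (hG : ∀ v, HasDerivAt G (g v) v) (c : ℝ) :
    ∫ v in (0 : ℝ)..1, outcome s p q f g c (u, v) =
      f u * (q + (u - p)) + (G 1 - G (q + (u - p))) - c := by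
  have hm : max 0 (u - p) = u - p := max_eq_right (by linarith)
  have hS : Searches s p q u := searches_of_le hs (by rw [hm]; linarith)
  have h := (integral_piecewise (f := fun v => outcome s p q f g c (u, v))
    (g := fun _ => f u - c) (h := fun v => g v - c) (a := 0) (b := q + (u - p)) (by linarith)
    (huA.trans hA1) (by simp) (Continuous.intervalIntegrable (by fun_prop) _ _)
    (fun v _ hv => by
      have h1 : BuysFirst s p q u v := ⟨hu.le, fun _ => by linarith⟩
      simp [outcome, hS, h1, h1.not_buysSecond])
    (fun v hv _ => by
      have h1 : BuysSecond s p q u v := ⟨hS, by linarith, by linarith⟩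
      have h2 : ¬ BuysFirst s p q u v := fun h => h.not_buysSecond h1
      simp [outcome, hS, h1, h2])).2
  rw [h, intervalIntegral.integral_sub (hg.intervalIntegrable _ _) (by simp),
    intervalIntegral.integral_eq_sub_of_hasDerivAt (fun v _ => hG v) (hg.intervalIntegrable _ _)]
  simp only [intervalIntegral.integral_const, smul_eq_mul]
  ring

/-- Conditional on `p < u` with the threshold above `A`, the consumer buys from the first seller. -/
lemma integral_outcome_of_not_searches {A s p q u : ℝ} (hA0 : 0 ≤ A) (hA1 : A ≤ 1)
    (hs : expectedSurplus A = s) (hu : p < u) (huA : A < q + (u - p))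
    {f g : ℝ → ℝ} {c : ℝ} (hc : A = 1 → c = 0) :
    ∫ v in (0 : ℝ)..1, outcome s p q f g c (u, v) = f u := by
  have hm : max 0 (u - p) = u - p := max_eq_right (by linarith)
  have hcS : ({z : ℝ × ℝ | Searches s p q z.1}).indicator (fun _ => c) (u, 0) = 0 := by
    rcases hA1.lt_or_eq with hlt | h1
    · have := not_searches hA0 hlt hs (p := p) (q := q) (u := u) (by rw [hm]; exact huA)
      simp [this]
    · simp [hc h1]
  have h := (integral_piecewise (f := fun v => outcome s p q f g c (u, v))
    (g := fun _ => f u) (h := fun _ => f u) (a := 0) (b := 1) (c := 1) zero_le_one le_rfl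
    (by simp) (by simp)
    (fun v _ hv => by
      have h1 : BuysFirst s p q u v :=
        (buysFirst_iff hA0 hA1 hs hv.le).2 ⟨hu.le, fun h => absurd h (by linarith)⟩
      have h2 := h1.not_buysSecond
      have h3 : ({z : ℝ × ℝ | Searches s p q z.1}).indicator (fun _ => c) (u, v) = 0 := hcS
      simp [outcome, h1, h2, h3])
    (fun v hv hv' => absurd hv (by linarith))).2
  rw [h]
  simp

/-- The case `q > A`: consumers with `u < p` do not search either, and buy nothing. -/
lemma integral_outcome_of_lt_of_gt {A s p q u : ℝ} (hA0 : 0 ≤ A)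
    (hs : expectedSurplus A = s) (hqA : A < q) (hq1 : q ≤ 1) (hu : u < p)
    {f g : ℝ → ℝ} {c : ℝ} :
    ∫ v in (0 : ℝ)..1, outcome s p q f g c (u, v) = 0 := by
  have hm : max 0 (u - p) = 0 := max_eq_left (by linarith)
  have hS : ¬ Searches s p q u := not_searches hA0 (by linarith) hs (by rw [hm]; linarith)
  simp [outcome, BuysFirst, BuysSecond, hS, hu]

/-- The mean payoff of a visit: consumers with `u < p` search, those with
`p < u < min 1 (A - q + p)` search and compare, and the others buy at once. -/
theorem integral_outcome {A s p q : ℝ} (hA0 : 0 ≤ A) (hA1 : A ≤ 1)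
    (hs : expectedSurplus A = s) (hp0 : 0 ≤ p) (hp1 : p ≤ 1) (hq0 : 0 ≤ q) (hqA : q ≤ A)
    {f g G : ℝ → ℝ} (hf : Continuous f) (hg : Continuous g)
    (hG : ∀ v, HasDerivAt G (g v) v) {c : ℝ} (hc : A = 1 → c = 0) :
    ∫ z, outcome s p q f g c z ∂matchPairLaw = p * (G 1 - G q - c)
      + (∫ u in p..min 1 (A - q + p), (f u * (q + (u - p)) + (G 1 - G (q + (u - p))) - c))
      + ∫ u in min 1 (A - q + p)..1, f u := by
  have hGc : Continuous G := continuous_iff_continuousAt.2 fun v => (hG v).continuousAt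
  have hT : p ≤ min 1 (A - q + p) := le_min hp1 (by linarith)
  have h1 := integral_piecewise
    (f := fun u => ∫ v in (0 : ℝ)..1, outcome s p q f g c (u, v))
    (g := fun _ => G 1 - G q - c)
    (h := fun u => f u * (q + (u - p)) + (G 1 - G (q + (u - p))) - c) hp0 hT
    (by simp) (Continuous.intervalIntegrable (by fun_prop) _ _)
    (fun u _ hu => integral_outcome_of_lt hA1 hs hq0 hqA hu hg hG c)
    (fun u hu hu' => integral_outcome_of_searches hA1 hs hq0 hu
      (by linarith [min_le_right 1 (A - q + p)]) hg hG c)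
  have h2 : IntervalIntegrable (fun u => ∫ v in (0 : ℝ)..1, outcome s p q f g c (u, v)) volume
        (min 1 (A - q + p)) 1 ∧
      ∫ u in min 1 (A - q + p)..1, (∫ v in (0 : ℝ)..1, outcome s p q f g c (u, v)) =
        ∫ u in min 1 (A - q + p)..1, f u := by
    have := integral_piecewise
      (f := fun u => ∫ v in (0 : ℝ)..1, outcome s p q f g c (u, v))
      (g := f) (h := f) le_rfl (min_le_left 1 (A - q + p)) (by simp) (hf.intervalIntegrable _ _)
      (fun u hu hu' => absurd hu (by linarith))
      (fun u hu hu' => integral_outcome_of_not_searches hA0 hA1 hs (by linarith)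
        (by rcases min_lt_iff.1 hu with h | h <;> linarith) hc)
    simpa using this
  rw [integral_outcome_eq_iterated s p q hf hg c,
    ← intervalIntegral.integral_add_adjacent_intervals h1.1 h2.1, h1.2, h2.2]
  simp only [intervalIntegral.integral_const, smul_eq_mul, sub_zero]

theorem integral_outcome_of_gt {A s p q : ℝ} (hA0 : 0 ≤ A) (hA1 : A ≤ 1)
    (hs : expectedSurplus A = s) (hp0 : 0 ≤ p) (hp1 : p ≤ 1) (hqA : A < q) (hq1 : q ≤ 1)
    {f g : ℝ → ℝ} (hf : Continuous f) (hg : Continuous g) {c : ℝ} (hc : A = 1 → c = 0) :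
    ∫ z, outcome s p q f g c z ∂matchPairLaw = ∫ u in p..1, f u := by
  rw [integral_outcome_eq_iterated s p q hf hg c,
    (integral_piecewise (g := fun _ => 0) (h := f) hp0 hp1 (by simp) (hf.intervalIntegrable _ _)
      (fun u _ hu => integral_outcome_of_lt_of_gt hA0 hs hqA hq1 hu)
      (fun u hu _ => integral_outcome_of_not_searches hA0 hA1 hs hu (by linarith) hc)).2]
  simp

lemma demandFirst_eq_integral (s p q : ℝ) :
    demandFirst s p q = ∫ z, outcome s p q (fun _ => 1) (fun _ => 0) 0 z ∂matchPairLaw := by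
  simp only [outcome, Set.indicator_zero, add_zero, sub_zero]
  rw [demandFirst, integral_indicator (measurableSet_buysFirst s p q)]
  simp

lemma demandSecond_eq_integral (s p q : ℝ) :
    demandSecond s p q = ∫ z, outcome s p q (fun _ => 0) (fun _ => 1) 0 z ∂matchPairLaw := by
  simp only [outcome, Set.indicator_zero, zero_add, sub_zero]
  rw [demandSecond, integral_indicator (measurableSet_buysSecond s p q)]
  simp

lemma orderedWelfare_eq_integral (s p q : ℝ) :
    orderedWelfare s p q = ∫ z, outcome s p q id id s z ∂matchPairLaw := by
  rw [orderedWelfare]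
  congr 1 with z
  by_cases h1 : BuysFirst s p q z.1 z.2
  · simp [outcome, Set.indicator, h1, h1.not_buysSecond]
  · simp [outcome, Set.indicator, h1]

lemma orderedSurplus_eq (s p q : ℝ) : orderedSurplus s p q =
    orderedWelfare s p q - p * demandFirst s p q - q * demandSecond s p q := by
  rw [orderedWelfare_eq_integral, demandFirst_eq_integral, demandSecond_eq_integral,
    ← integral_const_mul, ← integral_const_mul, ← integral_sub, ← integral_sub, orderedSurplus]
  · congr 1 with z
    by_cases h1 : BuysFirst s p q z.1 z.2
    · simp [outcome, Set.indicator, h1, h1.not_buysSecond]; ring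
    · by_cases h2 : BuysSecond s p q z.1 z.2
      · simp [outcome, Set.indicator, h1, h2]; ring
      · simp [outcome, Set.indicator, h1, h2]
  · exact (integrable_outcome _ _ _ continuous_id continuous_id _).sub
      ((integrable_outcome _ _ _ continuous_const continuous_const _).const_mul _)
  · exact (integrable_outcome _ _ _ continuous_const continuous_const _).const_mul _
  · exact integrable_outcome _ _ _ continuous_id continuous_id _
  · exact (integrable_outcome _ _ _ continuous_const continuous_const _).const_mul _

lemma integral_of_antideriv {f : ℝ → ℝ} (F : ℝ → ℝ) (a b : ℝ) (hf : Continuous f)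
    (h : ∀ x, HasDerivAt F (f x) x) : ∫ x in a..b, f x = F b - F a :=
  intervalIntegral.integral_eq_sub_of_hasDerivAt (fun x _ => h x) (hf.intervalIntegrable _ _)

lemma demandSecond_of_gt {A s p q : ℝ} (hA0 : 0 ≤ A) (hA1 : A ≤ 1) (hs : expectedSurplus A = s)
    (hqA : A < q) : demandSecond s p q = 0 := by
  rw [demandSecond, Measure.real, measure_eq_zero_iff_ae_notMem.2, ENNReal.toReal_zero]
  filter_upwards [ae_matchPairLaw] with z hz h
  have := ((buysSecond_iff hA0 hA1 hs hz.2.2).1 h).1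
  linarith [le_max_left 0 (z.1 - p)]

section Formulas

variable {A s p q : ℝ} (hA0 : 0 ≤ A) (hA1 : A ≤ 1) (hs : expectedSurplus A = s)
  (hp0 : 0 ≤ p) (hp1 : p ≤ 1)
include hA0 hA1 hs hp0 hp1

/-- Demand of the second seller, with `T` the largest `u` at which the consumer searches. -/
lemma demandSecond_eq (hq0 : 0 ≤ q) (hqA : q ≤ A) {T : ℝ} (hT : min 1 (A - q + p) = T) :
    demandSecond s p q = p * (1 - q) + ((1 - q) ^ 2 - (1 - q - (T - p)) ^ 2) / 2 := by
  rw [demandSecond_eq_integral, integral_outcome hA0 hA1 hs hp0 hp1 hq0 hqA continuous_const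
    continuous_const (fun v => hasDerivAt_id v) (fun _ => rfl), hT,
    integral_of_antideriv (fun u => -(1 - q - (u - p)) ^ 2 / 2) _ _ (by fun_prop) fun x => by
      have h := (((((hasDerivAt_id x).sub_const p).const_sub (1 - q)).pow 2).neg).div_const 2
      exact h.congr_deriv (by simp; ring)]
  simp; ring

lemma demandFirst_eq (hq0 : 0 ≤ q) (hqA : q ≤ A) {T : ℝ} (hT : min 1 (A - q + p) = T) :
    demandFirst s p q = ((q + (T - p)) ^ 2 - q ^ 2) / 2 + (1 - T) := by
  rw [demandFirst_eq_integral, integral_outcome hA0 hA1 hs hp0 hp1 hq0 hqA continuous_const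
    continuous_const (G := fun _ => 0) (fun v => hasDerivAt_const v 0) (fun _ => rfl), hT,
    integral_of_antideriv (fun u => (q + (u - p)) ^ 2 / 2) _ _ (by fun_prop) fun x => by
      have h := ((((hasDerivAt_id x).sub_const p).const_add q).pow 2).div_const 2
      exact h.congr_deriv (by simp)]
  simp; ring

lemma orderedWelfare_eq (hq0 : 0 ≤ q) (hqA : q ≤ A) {T : ℝ} (hT : min 1 (A - q + p) = T) :
    orderedWelfare s p q = p * ((1 - q ^ 2) / 2 - s) + (1 - p ^ 2) / 2
      + ((1 - p) ^ 3 - (1 - T) ^ 3) / 6 - ((q - p) ^ 2 / 2 + s) * (T - p) := by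
  have hc : A = 1 → s = 0 := fun h => by
    rw [← hs, expectedSurplus_of_mem hA0 hA1, h]; norm_num
  rw [orderedWelfare_eq_integral, integral_outcome hA0 hA1 hs hp0 hp1 hq0 hqA continuous_id
    continuous_id (G := fun v => v ^ 2 / 2) (fun v => by
      exact (((hasDerivAt_id v).pow 2).div_const 2).congr_deriv (by simp)) hc, hT,
    integral_of_antideriv (fun u => u ^ 2 / 2 - (1 - u) ^ 3 / 6 - ((q - p) ^ 2 / 2 + s) * u) _ _
      (by fun_prop) fun x => by
      have h := ((((hasDerivAt_id x).pow 2).div_const 2).sub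
        ((((hasDerivAt_id x).const_sub 1).pow 3).div_const 6)).sub
          ((hasDerivAt_id x).const_mul ((q - p) ^ 2 / 2 + s))
      exact h.congr_deriv (by simp; ring)]
  simp; ring

lemma demandFirst_of_gt (hqA : A < q) (hq1 : q ≤ 1) : demandFirst s p q = 1 - p := by
  rw [demandFirst_eq_integral, integral_outcome_of_gt hA0 hA1 hs hp0 hp1 hqA hq1 continuous_const
    continuous_const (fun _ => rfl)]
  simp

lemma orderedWelfare_of_gt (hqA : A < q) (hq1 : q ≤ 1) :
    orderedWelfare s p q = (1 - p ^ 2) / 2 := by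
  have hc : A = 1 → s = 0 := fun h => by
    rw [← hs, expectedSurplus_of_mem hA0 hA1, h]; norm_num
  rw [orderedWelfare_eq_integral, integral_outcome_of_gt hA0 hA1 hs hp0 hp1 hqA hq1 continuous_id
    continuous_id hc]
  simp

end Formulas

/-! ### Demand by price regime -/

section Regimes

variable {A s p q : ℝ} (hA0 : 0 ≤ A) (hA1 : A ≤ 1) (hs : expectedSurplus A = s)
include hA0 hA1 hs

lemma searchCost_eq : s = (1 - A) ^ 2 / 2 := by rw [← hs, expectedSurplus_of_mem hA0 hA1]

/-- Demand of the second seller when its price is not so low that every consumer searches. -/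
lemma demandSecond_of_near (hp0 : 0 ≤ p) (hp1 : p ≤ 1) (hq0 : 0 ≤ q) (hqA : q ≤ A)
    (h : p - (1 - A) ≤ q) : demandSecond s p q = p * (1 - q) + (1 - q) ^ 2 / 2 - s := by
  rw [demandSecond_eq hA0 hA1 hs hp0 hp1 hq0 hqA (min_eq_right (by linarith)),
    searchCost_eq hA0 hA1 hs]
  ring

/-- Demand of the second seller when its price is so low that every consumer searches. -/
lemma demandSecond_of_far (hp0 : 0 ≤ p) (hp1 : p ≤ 1) (hq0 : 0 ≤ q) (hqA : q ≤ A)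
    (h : q ≤ p - (1 - A)) :
    demandSecond s p q = p * (1 - q) + (1 - q) ^ 2 / 2 - (p - q) ^ 2 / 2 := by
  rw [demandSecond_eq hA0 hA1 hs hp0 hp1 hq0 hqA (min_eq_left (by linarith))]
  ring

lemma demandFirst_of_near (hp0 : 0 ≤ p) (hp1 : p ≤ 1) (hq0 : 0 ≤ q) (hqA : q ≤ A)
    (h : p ≤ q + (1 - A)) : demandFirst s p q = 1 / 2 - p + q - q ^ 2 / 2 + s := by
  rw [demandFirst_eq hA0 hA1 hs hp0 hp1 hq0 hqA (min_eq_right (by linarith)),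
    searchCost_eq hA0 hA1 hs]
  ring

lemma demandFirst_of_far (hp0 : 0 ≤ p) (hp1 : p ≤ 1) (hq0 : 0 ≤ q) (hqA : q ≤ A)
    (h : q + (1 - A) ≤ p) : demandFirst s p q = q * (1 - p) + (1 - p) ^ 2 / 2 := by
  rw [demandFirst_eq hA0 hA1 hs hp0 hp1 hq0 hqA (min_eq_left (by linarith))]
  ring

lemma demandFirst_add_demandSecond (hp0 : 0 ≤ p) (hp1 : p ≤ 1) (hq0 : 0 ≤ q) (hqA : q ≤ A) :
    demandFirst s p q + demandSecond s p q = 1 - p * q := by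
  rw [demandFirst_eq hA0 hA1 hs hp0 hp1 hq0 hqA rfl,
    demandSecond_eq hA0 hA1 hs hp0 hp1 hq0 hqA rfl]
  ring

lemma demandFirst_add_demandSecond_le (hp0 : 0 ≤ p) (hp1 : p ≤ 1) (hq0 : 0 ≤ q) (hq1 : q ≤ 1) :
    demandFirst s p q + demandSecond s p q ≤ 1 - p * q := by
  rcases le_or_gt q A with h | h
  · exact (demandFirst_add_demandSecond hA0 hA1 hs hp0 hp1 hq0 h).le
  · rw [demandFirst_of_gt hA0 hA1 hs hp0 hp1 h hq1, demandSecond_of_gt hA0 hA1 hs h]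
    nlinarith

lemma demandSecond_le_of_le (hp0 : 0 ≤ p) (hp1 : p ≤ 1) (hq0 : 0 ≤ q) (hqA : q ≤ A) :
    demandSecond s p q ≤ p * (1 - q) + (1 - q) ^ 2 / 2 - s := by
  rcases le_total (p - (1 - A)) q with h | h
  · exact (demandSecond_of_near hA0 hA1 hs hp0 hp1 hq0 hqA h).le
  · rw [demandSecond_of_far hA0 hA1 hs hp0 hp1 hq0 hqA h, searchCost_eq hA0 hA1 hs]
    nlinarith

lemma demandSecond_le (hp0 : 0 ≤ p) (hp1 : p ≤ 1) (hq0 : 0 ≤ q) (hq1 : q ≤ 1) :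
    demandSecond s p q ≤ p * (1 - q) + (1 - q) ^ 2 / 2 := by
  rcases le_or_gt q A with h | h
  · have := demandSecond_le_of_le hA0 hA1 hs hp0 hp1 hq0 h
    have := expectedSurplus_nonneg A
    linarith
  · rw [demandSecond_of_gt hA0 hA1 hs h]
    have : 0 ≤ 1 - q := by linarith
    positivity

lemma continuousOn_demandSecond (hq0 : 0 ≤ q) :
    ContinuousOn (fun p => demandSecond s p q) (Set.Icc 0 1) := by
  rcases le_or_gt q A with h | h
  · exact ContinuousOn.congr (f := fun p => p * (1 - q)
      + ((1 - q) ^ 2 - (1 - q - (min 1 (A - q + p) - p)) ^ 2) / 2) (by fun_prop)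
      fun p hp => demandSecond_eq hA0 hA1 hs hp.1 hp.2 hq0 h rfl
  · exact continuousOn_const.congr fun p _ => demandSecond_of_gt hA0 hA1 hs h

end Regimes

lemma demandFirst_nonneg (s p q : ℝ) : 0 ≤ demandFirst s p q := measureReal_nonneg

lemma demandSecond_nonneg (s p q : ℝ) : 0 ≤ demandSecond s p q := measureReal_nonneg

lemma demandSecond_mono (s q : ℝ) : Monotone fun p => demandSecond s p q := fun p p' h => by
  refine measureReal_mono (fun z hz => ⟨?_, hz.2.1, by linarith [hz.2.2]⟩)
  exact hz.1.trans (expectedSurplus_antitone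
    (add_le_add_right (max_le_max le_rfl (by linarith)) q))

lemma demandFirst_of_one_le {s p q : ℝ} (hp : 1 ≤ p) : demandFirst s p q = 0 := by
  rw [demandFirst_eq_integral, integral_outcome_eq_iterated s p q continuous_const
    continuous_const, (integral_piecewise (g := fun _ => 0) (h := fun _ => 0) zero_le_one le_rfl
      (by simp) (by simp) (fun u _ hu => ?_) (fun u hu hu' => absurd hu (by linarith))).2]
  · simp
  · have : ¬ p ≤ u := by linarith
    simp [outcome, BuysFirst, this]

lemma demandSecond_of_one_le {s p q : ℝ} (hq : 1 ≤ q) : demandSecond s p q = 0 := by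
  rw [demandSecond_eq_integral, integral_outcome_eq_iterated s p q continuous_const
    continuous_const]
  have h : ∀ u : ℝ, ∫ v in (0 : ℝ)..1, outcome s p q (fun _ => 0) (fun _ => 1) 0 (u, v) = 0 := by
    intro u
    rw [(integral_piecewise (g := fun _ => 0) (h := fun _ => 0) zero_le_one le_rfl
      (by simp) (by simp) (fun v _ hv => ?_) (fun v hv hv' => absurd hv (by linarith))).2]
    · simp
    · have : ¬ q ≤ v := by linarith
      simp [outcome, BuysSecond, this]
  simp [h]

/-- If the first seller's price is not positive, every consumer buys. -/
lemma one_le_demandFirst_add_demandSecond {s p : ℝ} (hp : p ≤ 0) (q : ℝ) :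
    1 ≤ demandFirst s p q + demandSecond s p q := by
  have h1 : (1 : ℝ) ≤ matchPairLaw.real ({z | BuysFirst s p q z.1 z.2} ∪
      {z | BuysSecond s p q z.1 z.2}) := by
    rw [← probReal_univ (μ := matchPairLaw)]
    refine (measureReal_congr ?_).le
    filter_upwards [ae_matchPairLaw] with z hz
    refine (eq_iff_iff.2 (iff_of_true trivial ?_))
    change BuysFirst s p q z.1 z.2 ∨ BuysSecond s p q z.1 z.2
    have h0 : p ≤ z.1 := hp.trans hz.1.1
    by_cases hS : Searches s p q z.1
    · rcases le_or_gt (z.2 - q) (z.1 - p) with h | h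
      · exact Or.inl ⟨h0, fun _ => h⟩
      · exact Or.inr ⟨hS, by linarith, h⟩
    · exact Or.inl ⟨h0, fun h => absurd h hS⟩
  exact h1.trans (measureReal_union_le _ _)

lemma mem_implementableContracts {s a b α : ℝ} : (a, b, α) ∈ implementableContracts s ↔
    α ∈ Set.Icc (0 : ℝ) 1 ∧
    (∀ t, t * demandSecond s b t ≤
      α * (a * demandFirst s a b) + (1 - α) * (a * demandSecond s b a)) ∧
    (∀ t, t * demandSecond s a t ≤
      α * (b * demandSecond s a b) + (1 - α) * (b * demandFirst s b a)) :=
  Iff.rfl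

/-- Renaming the sellers. -/
lemma swap_mem_implementableContracts {s a b α : ℝ} (h : (a, b, α) ∈ implementableContracts s) :
    (b, a, 1 - α) ∈ implementableContracts s := by
  rw [mem_implementableContracts] at h ⊢
  obtain ⟨⟨h0, h1⟩, h2, h3⟩ := h
  refine ⟨⟨by linarith, by linarith⟩, fun t => ?_, fun t => ?_⟩
  · linarith [h3 t]
  · linarith [h2 t]

lemma profitOne_nonneg_of_mem {s a b α : ℝ} (h : (a, b, α) ∈ implementableContracts s) :
    0 ≤ α * (a * demandFirst s a b) + (1 - α) * (a * demandSecond s b a) := by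
  simpa using (mem_implementableContracts.1 h).2.1 0

/-! ### Implementable prices lie between zero and one -/

section Prices

variable {A s : ℝ} (hA : 99 / 100 ≤ A) (hA1 : A ≤ 1) (hs : expectedSurplus A = s)
include hA hA1 hs

lemma exists_profitable_deviation {q : ℝ} (hq : 0 ≤ q) :
    0 < (1 / 2 : ℝ) * demandSecond s q (1 / 2) := by
  have h0 : (0 : ℝ) ≤ A := by linarith
  have h1 := demandSecond_of_near h0 hA1 hs (p := 0) (q := 1 / 2) le_rfl zero_le_one (by norm_num)
    (by linarith) (by linarith)
  have h2 := demandSecond_mono s (1 / 2) hq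
  have h3 := searchCost_eq h0 hA1 hs
  simp only at h2
  nlinarith

lemma pos_of_mem {a b α : ℝ} (h : (a, b, α) ∈ implementableContracts s) : 0 < a := by
  -- a seller with `a ≤ 0` has no profit, while the constraint gives it that of a deviation
  have key : ∀ {a b α : ℝ}, (a, b, α) ∈ implementableContracts s → a ≤ 0 → b < 0 := by
    intro a b α h ha
    obtain ⟨⟨h0, h1⟩, h2, -⟩ := mem_implementableContracts.1 h
    by_contra! hb
    have h3 := exists_profitable_deviation hA hA1 hs hb
    have h4 := h2 (1 / 2)
    have h5 := mul_nonneg h0 (demandFirst_nonneg s a b)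
    have h6 := mul_nonneg (sub_nonneg.2 h1) (demandSecond_nonneg s b a)
    nlinarith
  by_contra! ha
  have hb := key h ha
  have ha' := key (swap_mem_implementableContracts h) hb.le
  obtain ⟨⟨h0, h1⟩, -, -⟩ := mem_implementableContracts.1 h
  have e1 := profitOne_nonneg_of_mem h
  have e2 := profitOne_nonneg_of_mem (swap_mem_implementableContracts h)
  have d1 := one_le_demandFirst_add_demandSecond (s := s) ha b
  have d2 := one_le_demandFirst_add_demandSecond (s := s) hb.le a
  have n1 : α * demandFirst s a b + (1 - α) * demandSecond s b a ≤ 0 := by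
    by_contra! hn
    nlinarith [mul_neg_of_neg_of_pos ha' hn]
  have n2 : (1 - α) * demandFirst s b a + α * demandSecond s a b ≤ 0 := by
    by_contra! hn
    nlinarith [mul_neg_of_neg_of_pos hb hn]
  nlinarith

lemma lt_one_of_mem {a b α : ℝ} (h : (a, b, α) ∈ implementableContracts s) : a < 1 := by
  have hb := pos_of_mem hA hA1 hs (swap_mem_implementableContracts h)
  by_contra! ha
  have h1 := (mem_implementableContracts.1 h).2.1 (1 / 2)
  rw [demandFirst_of_one_le ha, demandSecond_of_one_le ha] at h1
  linarith [exists_profitable_deviation hA hA1 hs hb.le]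

end Prices

/-! ### Implementable prices on the diagonal -/

/-- Profit of a second-ranked seller with price `t` against `q`, if consumers search exactly when
they would at nearly equal prices. It is affine in `q`, bounds the true profit from above, and
agrees with it for `q - (1 - A) ≤ t ≤ A` (all prices being in `[0, 1]`). -/
noncomputable def secondProfit (s q t : ℝ) : ℝ := t * (q * (1 - t) + (1 - t) ^ 2 / 2 - s)

/-- The prices `p` at which no deviation `t`, evaluated by `secondProfit`, beats half the industry
profit `p * (1 - p ^ 2)` of the price vector `(p, p)`. -/
def diagonalPrices (A s : ℝ) : Set ℝ :=
  {p | p ∈ Set.Icc 0 1 ∧ ∀ t ∈ Set.Icc 0 A, secondProfit s p t ≤ p * (1 - p ^ 2) / 2}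

/-- The marginal profit of an own price increase changes sign at the equilibrium price `q`, which
solves `q ^ 2 + 2 * q = 1 - 2 * s`. -/
lemma mem_diagonalPrices_of_equilibrium {A s q : ℝ} (hA1 : A ≤ 1) (hs0 : 0 ≤ s)
    (hq : q ∈ Set.Icc (0 : ℝ) 1) (h : q ^ 2 + 2 * q = 1 - 2 * s) : q ∈ diagonalPrices A s := by
  refine ⟨hq, fun t ht => ?_⟩
  obtain rfl : s = (1 - 2 * q - q ^ 2) / 2 := by linarith
  have h1 : 0 ≤ (t - q) ^ 2 * (1 - t / 2) := mul_nonneg (sq_nonneg _) (by linarith [ht.2])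
  have h2 := mul_nonneg hq.1 hs0
  unfold secondProfit
  nlinarith

lemma isClosed_diagonalPrices (A s : ℝ) : IsClosed (diagonalPrices A s) := by
  have : diagonalPrices A s = Set.Icc 0 1 ∩ ⋂ t ∈ Set.Icc 0 A,
      {p | secondProfit s p t ≤ p * (1 - p ^ 2) / 2} := by
    ext p; simp [diagonalPrices]
  rw [this]
  refine isClosed_Icc.inter (isClosed_biInter fun t _ => ?_)
  unfold secondProfit
  exact isClosed_le (by fun_prop) (by fun_prop)

lemma isCompact_diagonalPrices (A s : ℝ) : IsCompact (diagonalPrices A s) :=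
  isCompact_Icc.of_isClosed_subset (isClosed_diagonalPrices A s) fun _ h => h.1

/-- Strictly between two elements no deviation comes close to being profitable, as `secondProfit`
is affine in `p` while `p * (1 - p ^ 2) / 2` is strictly concave. -/
lemma exists_slack {A s a b p : ℝ} (ha : a ∈ diagonalPrices A s) (hb : b ∈ diagonalPrices A s)
    (hap : a < p) (hpb : p < b) :
    ∃ κ > 0, ∀ t ∈ Set.Icc 0 A, secondProfit s p t + κ ≤ p * (1 - p ^ 2) / 2 := by
  have ha0 := ha.1.1
  refine ⟨(p - a) * (b - p) * (a + b + p) / 2, ?_, fun t ht => ?_⟩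
  · have h1 := sub_pos.2 hap
    have h2 := sub_pos.2 hpb
    have : 0 < a + b + p := by linarith
    positivity
  · have h1 := mul_le_mul_of_nonneg_left (ha.2 t ht) (sub_pos.2 hpb).le
    have h2 := mul_le_mul_of_nonneg_left (hb.2 t ht) (sub_pos.2 hap).le
    have hba : 0 < b - a := by linarith
    refine le_of_mul_le_mul_left ?_ hba
    have h3 : (b - a) * secondProfit s p t
        = (b - p) * secondProfit s a t + (p - a) * secondProfit s b t := by
      unfold secondProfit; ring
    rw [mul_add, h3]
    nlinarith

lemma secondProfit_mono {s t : ℝ} (h0 : 0 ≤ t) (h1 : t ≤ 1) :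
    Monotone fun q => secondProfit s q t := fun q q' h => by
  have := mul_le_mul_of_nonneg_left h (mul_nonneg h0 (sub_nonneg.2 h1))
  simp only [secondProfit]
  nlinarith

/-- At the smallest element a deviation exists that is exactly as good as compliance. -/
lemma exists_binding_deviation {A s c : ℝ} (hA0 : 0 ≤ A) (hA1 : A ≤ 1) (hc0 : 0 < c)
    (hc : IsLeast (diagonalPrices A s) c) : ∃ r ∈ Set.Icc 0 A,
      secondProfit s c r = c * (1 - c ^ 2) / 2 ∧
      ∀ t ∈ Set.Icc 0 A, secondProfit s c t ≤ secondProfit s c r := by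
  have hcont : ContinuousOn (secondProfit s c) (Set.Icc 0 A) := by
    unfold secondProfit; fun_prop
  obtain ⟨r, hr, hmax⟩ := isCompact_Icc.exists_isMaxOn (Set.nonempty_Icc.2 hA0) hcont
  refine ⟨r, hr, le_antisymm (hc.1.2 r hr) ?_, hmax⟩
  by_contra! hlt
  have h1 : ∀ᶠ p in nhds c, secondProfit s c r < p * (1 - p ^ 2) / 2 :=
    ContinuousAt.eventually_lt (by fun_prop) (by fun_prop) hlt
  have h2 : ∀ᶠ p in nhdsWithin c (Set.Iio c), False := by
    filter_upwards [h1.filter_mono nhdsWithin_le_nhds, self_mem_nhdsWithin,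
      (lt_mem_nhds hc0).filter_mono nhdsWithin_le_nhds] with p hp hpc hp0
    have hpc' : p < c := hpc
    refine hpc'.not_ge (hc.2 ⟨⟨hp0.le, hpc'.le.trans hc.1.1.2⟩, fun t ht => ?_⟩)
    exact (secondProfit_mono ht.1 (ht.2.trans hA1) hpc'.le).trans ((hmax ht).trans hp.le)
  exact (nhdsLT_neBot c).ne (Filter.eventually_false_iff_eq_bot.1 h2)

lemma bounds_of_mem_diagonalPrices {A s p : ℝ} (hA : 99 / 100 ≤ A) (hs : s ≤ 1 / 20000)
    (hp : p ∈ diagonalPrices A s) : 7 / 20 < p ∧ p < 1 / 2 := by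
  have h := hp.2 (2 / 5) ⟨by norm_num, by linarith⟩
  have h0 := hp.1.1
  have h1 := hp.1.2
  unfold secondProfit at h
  constructor
  · by_contra! hle
    nlinarith [mul_nonneg h0 (sub_nonneg.2 hle), mul_nonneg h0 (sq_nonneg (p - 2 / 5))]
  · by_contra! hle
    nlinarith [mul_nonneg h0 (sub_nonneg.2 hle), mul_nonneg h0 (sq_nonneg (p - 1 / 2))]

section

variable {A s p : ℝ} (hA : 99 / 100 ≤ A) (hA1 : A ≤ 1) (hs : expectedSurplus A = s)
include hA hA1 hs

lemma searchCost_le : s ≤ 1 / 20000 := by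
  rw [searchCost_eq (by linarith) hA1 hs]; nlinarith

lemma mul_demandSecond_le {t X : ℝ} (hp0 : 0 ≤ p) (hp1 : p ≤ 1) (hX : 0 ≤ X)
    (h : ∀ t ∈ Set.Icc 0 A, secondProfit s p t ≤ X) : t * demandSecond s p t ≤ X := by
  have hA0 : 0 ≤ A := by linarith
  rcases lt_or_ge t 0 with ht | ht
  · have := mul_nonneg_of_nonpos_of_nonpos ht.le (neg_nonpos.2 (demandSecond_nonneg s p t))
    linarith
  rcases le_or_gt t A with htA | htA
  · exact (mul_le_mul_of_nonneg_left (demandSecond_le_of_le hA0 hA1 hs hp0 hp1 ht htA) ht).trans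
      (h t ⟨ht, htA⟩)
  · rw [demandSecond_of_gt hA0 hA1 hs htA, mul_zero]; exact hX

lemma mul_demandSecond_eq {t : ℝ} (hp0 : 0 ≤ p) (hp1 : p ≤ 1) (ht0 : 0 ≤ t) (htA : t ≤ A)
    (h : p - (1 - A) ≤ t) : t * demandSecond s p t = secondProfit s p t := by
  rw [demandSecond_of_near (by linarith) hA1 hs hp0 hp1 ht0 htA h]; rfl

/-- Evaluating deviations by `secondProfit` is harmless on the diagonal. If `p` is so high that some
deviation below `p - (1 - A)` matters, then `p - (1 - A)` itself is the best one among these, and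
its evaluation is exact. -/
lemma mem_diagonalPrices_iff : p ∈ diagonalPrices A s ↔
    p ∈ Set.Icc 0 1 ∧ ∀ t, t * demandSecond s p t ≤ p * (1 - p ^ 2) / 2 := by
  have hA0 : 0 ≤ A := by linarith
  constructor
  · rintro ⟨⟨h0, h1⟩, h⟩
    have : 0 ≤ 1 - p ^ 2 := by nlinarith
    exact ⟨⟨h0, h1⟩, fun t => mul_demandSecond_le hA hA1 hs h0 h1 (by positivity) h⟩
  · rintro ⟨⟨h0, h1⟩, h⟩
    refine ⟨⟨h0, h1⟩, fun t ht => ?_⟩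
    rcases le_or_gt (p - (1 - A)) t with hnear | hfar
    · rw [← mul_demandSecond_eq hA hA1 hs h0 h1 ht.1 ht.2 hnear]; exact h t
    set e := 1 - A with he
    have he0 : 0 ≤ e := by linarith
    have he1 : e ≤ 1 / 100 := by linarith
    have ht0 : 0 ≤ t := ht.1
    have hse : s = e ^ 2 / 2 := searchCost_eq hA0 hA1 hs
    have hdev : ∀ y, e ≤ y → y ≤ p → y * (p ^ 2 + 2 * p - 1 - 2 * y) ≤ 0 := fun y hy hyp => by
      have := h (p - y)
      rw [demandSecond_of_far hA0 hA1 hs h0 h1 (by linarith) (by linarith) (by linarith)] at this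
      nlinarith
    have hp : p ^ 2 + 2 * p - 1 ≤ 2 * e := by
      by_contra! hlt
      -- otherwise undercutting `p` by slightly more than `e` is profitable
      set y := min p ((e + (p ^ 2 + 2 * p - 1) / 2) / 2)
      have hy : e < y := lt_min (by linarith) (by linarith)
      have hy' : y < (p ^ 2 + 2 * p - 1) / 2 := (min_le_right _ _).trans_lt (by linarith)
      nlinarith [hdev y hy.le (min_le_left _ _)]
    have hr := h (p - e)
    rw [mul_demandSecond_eq hA hA1 hs h0 h1 (by linarith) (by linarith) le_rfl] at hr
    refine le_trans ?_ hr
    have h3 : 0 ≤ (p - e - t) * ((p - e - t) * (1 + p - (2 * (p - e) + t) / 2)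
        + ((1 - p ^ 2 - 2 * p) / 2 + e * (2 - p) + e ^ 2)) := by
      have h4 : 0 ≤ p - e - t := by linarith
      have h5 : 0 ≤ 1 + p - (2 * (p - e) + t) / 2 := by linarith
      have h6 : 0 ≤ e * (1 - p) := mul_nonneg he0 (by linarith)
      have h7 : 0 ≤ (1 - p ^ 2 - 2 * p) / 2 + e * (2 - p) + e ^ 2 := by nlinarith
      positivity
    unfold secondProfit
    rw [hse]
    linarith

lemma symmetric_mem_implementableContracts (hp : p ∈ diagonalPrices A s) :
    (p, p, (1 / 2 : ℝ)) ∈ implementableContracts s := by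
  have hA0 : 0 ≤ A := by linarith
  have hb := bounds_of_mem_diagonalPrices hA (searchCost_le hA hA1 hs) hp
  have hd := demandFirst_add_demandSecond hA0 hA1 hs (p := p) (q := p) (by linarith) (by linarith)
    (by linarith) (by linarith)
  have h := ((mem_diagonalPrices_iff hA hA1 hs).1 hp).2
  refine mem_implementableContracts.2 ⟨by norm_num, fun t => ?_, fun t => ?_⟩ <;>
  · have := h t
    have h2 : demandFirst s p p = 1 - p * p - demandSecond s p p := by linarith
    rw [h2]
    linarith

lemma implementable_sum_le {a b α t : ℝ} (h : (a, b, α) ∈ implementableContracts s) :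
    t * demandSecond s a t + t * demandSecond s b t ≤ max a b * (1 - a * b) := by
  have ha0 := pos_of_mem hA hA1 hs h
  have hb0 := pos_of_mem hA hA1 hs (swap_mem_implementableContracts h)
  have ha1 := lt_one_of_mem hA hA1 hs h
  have hb1 := lt_one_of_mem hA hA1 hs (swap_mem_implementableContracts h)
  have hA0 : 0 ≤ A := by linarith
  obtain ⟨⟨h0, h1⟩, h2, h3⟩ := mem_implementableContracts.1 h
  have e1 := demandFirst_add_demandSecond_le hA0 hA1 hs ha0.le ha1.le hb0.le hb1.le
  have e2 := demandFirst_add_demandSecond_le hA0 hA1 hs hb0.le hb1.le ha0.le ha1.le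
  have n1 := mul_nonneg h0 (demandFirst_nonneg s a b)
  have n2 := mul_nonneg (sub_nonneg.2 h1) (demandSecond_nonneg s b a)
  have n3 := mul_nonneg h0 (demandSecond_nonneg s a b)
  have n4 := mul_nonneg (sub_nonneg.2 h1) (demandFirst_nonneg s b a)
  have m1 := mul_le_mul_of_nonneg_right (le_max_left a b) (add_nonneg n1 n2)
  have m2 := mul_le_mul_of_nonneg_right (le_max_right a b) (add_nonneg n3 n4)
  have m3 : max a b * (α * (demandFirst s a b + demandSecond s a b)
      + (1 - α) * (demandFirst s b a + demandSecond s b a)) ≤ max a b * (1 - a * b) := by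
    refine mul_le_mul_of_nonneg_left ?_ (le_max_of_le_left ha0.le)
    nlinarith [mul_le_mul_of_nonneg_left e1 h0, mul_le_mul_of_nonneg_left e2 (sub_nonneg.2 h1)]
  linarith [h2 t, h3 t]

/-- The deviations that rule out a diagonal point rule out a neighbourhood of it. -/
lemma mem_diagonalPrices_of_mem_closure (h : (p, p) ∈ closure (implementablePrices s)) :
    p ∈ diagonalPrices A s := by
  have hA0 : 0 ≤ A := by linarith
  have key : ∀ t, 0 ≤ t → (p, p) ∈ {x ∈ Set.Icc (0 : ℝ) 1 ×ˢ Set.Icc (0 : ℝ) 1 |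
      t * demandSecond s x.1 t + t * demandSecond s x.2 t ≤ max x.1 x.2 * (1 - x.1 * x.2)} := by
    intro t ht
    have hc := continuousOn_demandSecond hA0 hA1 hs ht
    have h1 : ContinuousOn (fun x : ℝ × ℝ => demandSecond s x.1 t)
        (Set.Icc (0 : ℝ) 1 ×ˢ Set.Icc (0 : ℝ) 1) :=
      hc.comp continuousOn_fst fun x hx => hx.1
    have h2 : ContinuousOn (fun x : ℝ × ℝ => demandSecond s x.2 t)
        (Set.Icc (0 : ℝ) 1 ×ˢ Set.Icc (0 : ℝ) 1) :=
      hc.comp continuousOn_snd fun x hx => hx.2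
    have hcl := IsClosed.isClosed_le (isClosed_Icc.prod isClosed_Icc)
      ((h1.const_mul t).add (h2.const_mul t))
      (g := fun x : ℝ × ℝ => max x.1 x.2 * (1 - x.1 * x.2)) (by fun_prop)
    refine closure_minimal ?_ hcl h
    rintro ⟨a, b⟩ ⟨α, hα⟩
    have hα' := swap_mem_implementableContracts hα
    exact ⟨⟨⟨(pos_of_mem hA hA1 hs hα).le, (lt_one_of_mem hA hA1 hs hα).le⟩,
      ⟨(pos_of_mem hA hA1 hs hα').le, (lt_one_of_mem hA hA1 hs hα').le⟩⟩,
      implementable_sum_le hA hA1 hs hα⟩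
  have hp := (key 0 le_rfl).1.1
  refine (mem_diagonalPrices_iff hA hA1 hs).2 ⟨hp, fun t => ?_⟩
  rcases lt_or_ge t 0 with ht | ht
  · have h1 := mul_nonneg_of_nonpos_of_nonpos ht.le (neg_nonpos.2 (demandSecond_nonneg s p t))
    have h2 : 0 ≤ 1 - p ^ 2 := by nlinarith [hp.1, hp.2]
    have h3 := mul_nonneg hp.1 h2
    linarith
  · have := (key t ht).2
    simp only [max_self] at this
    linarith

lemma mem_interior_of_slack {κ : ℝ} (hp : p ∈ diagonalPrices A s) (hκ : 0 < κ)
    (h : ∀ t ∈ Set.Icc 0 A, secondProfit s p t + κ ≤ p * (1 - p ^ 2) / 2) :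
    (p, p) ∈ interior (implementablePrices s) := by
  have hA0 : 0 ≤ A := by linarith
  obtain ⟨hb0, hb1⟩ := bounds_of_mem_diagonalPrices hA (searchCost_le hA hA1 hs) hp
  have hse := searchCost_eq hA0 hA1 hs
  -- complying earns `s * p` more than the deviation to `p` itself, so slack needs `0 < s`
  have hAlt : A < 1 := by
    refine lt_of_le_of_ne hA1 ?_
    rintro rfl
    have := h p ⟨by linarith, by linarith⟩
    unfold secondProfit at this
    nlinarith
  rw [mem_interior_iff_mem_nhds]
  have hprofit : ∀ᶠ x in nhds (p, p), p * (1 - p ^ 2) / 2 - κ + |x.2 - p| <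
      1 / 2 * (x.1 * (1 / 2 - x.1 + x.2 - x.2 ^ 2 / 2 + s))
        + (1 - 1 / 2) * (x.1 * (x.2 * (1 - x.1) + (1 - x.1) ^ 2 / 2 - s)) := by
    refine ContinuousAt.eventually_lt (by fun_prop) (by fun_prop) ?_
    simp only [sub_self, abs_zero]
    nlinarith
  have hprofit' : ∀ᶠ x in nhds (p, p), p * (1 - p ^ 2) / 2 - κ + |x.1 - p| <
      1 / 2 * (x.2 * (x.1 * (1 - x.2) + (1 - x.2) ^ 2 / 2 - s))
        + (1 - 1 / 2) * (x.2 * (1 / 2 - x.2 + x.1 - x.1 ^ 2 / 2 + s)) := by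
    refine ContinuousAt.eventually_lt (by fun_prop) (by fun_prop) ?_
    simp only [sub_self, abs_zero]
    nlinarith
  have hnear : ∀ᶠ x in nhds (p, p), x.1 - x.2 < 1 - A ∧ x.2 - x.1 < 1 - A := by
    refine (ContinuousAt.eventually_lt (by fun_prop) (by fun_prop) ?_).and
      (ContinuousAt.eventually_lt (by fun_prop) (by fun_prop) ?_) <;> simp <;> linarith
  have hbox : ∀ᶠ x in nhds (p, p), (0 < x.1 ∧ x.1 < 1 / 2) ∧ 0 < x.2 ∧ x.2 < 1 / 2 := by
    refine ((ContinuousAt.eventually_lt (by fun_prop) (by fun_prop) ?_).and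
      (ContinuousAt.eventually_lt (by fun_prop) (by fun_prop) ?_)).and
      ((ContinuousAt.eventually_lt (by fun_prop) (by fun_prop) ?_).and
      (ContinuousAt.eventually_lt (by fun_prop) (by fun_prop) ?_)) <;> simp only <;> linarith
  have hdev : ∀ q, 0 < q → q < 1 / 2 → 0 ≤ p * (1 - p ^ 2) / 2 - κ → ∀ t,
      t * demandSecond s q t ≤ p * (1 - p ^ 2) / 2 - κ + |q - p| := by
    intro q hq0 hq1 hnn t
    refine mul_demandSecond_le hA hA1 hs hq0.le (by linarith)
      (add_nonneg hnn (abs_nonneg _)) fun t ht => ?_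
    have h1 := h t ht
    have h2 : secondProfit s q t = secondProfit s p t + t * (1 - t) * (q - p) := by
      unfold secondProfit; ring
    have h3 : 0 ≤ t * (1 - t) := mul_nonneg ht.1 (by linarith [ht.2])
    have h4 : t * (1 - t) ≤ 1 := by nlinarith [sq_nonneg t, sq_nonneg (1 - t)]
    have h5 := mul_le_mul_of_nonneg_left (le_abs_self (q - p)) h3
    have h6 := mul_le_mul_of_nonneg_right h4 (abs_nonneg (q - p))
    linarith
  have hnn : 0 ≤ p * (1 - p ^ 2) / 2 - κ := by
    have := h 0 ⟨le_rfl, hA0⟩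
    simp only [secondProfit, zero_mul] at this
    linarith
  filter_upwards [hprofit, hprofit', hnear, hbox] with x h1 h2 h3 h4
  obtain ⟨a, b⟩ := x
  obtain ⟨⟨ha0, ha1⟩, hb0', hb1'⟩ := h4
  simp only at *
  refine ⟨1 / 2, mem_implementableContracts.2 ⟨by norm_num, fun t => ?_, fun t => ?_⟩⟩
  · rw [demandFirst_of_near hA0 hA1 hs ha0.le (by linarith) hb0'.le (by linarith) (by linarith),
      demandSecond_of_near hA0 hA1 hs hb0'.le (by linarith) ha0.le (by linarith) (by linarith)]
    exact (hdev b hb0' hb1' hnn t).trans h1.le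
  · rw [demandFirst_of_near hA0 hA1 hs hb0'.le (by linarith) ha0.le (by linarith) (by linarith),
      demandSecond_of_near hA0 hA1 hs ha0.le (by linarith) hb0'.le (by linarith) (by linarith)]
    exact (hdev a ha0 ha1 hnn t).trans h2.le

end

/-! ### Prices and profits of implementable contracts -/

/-- First-order condition and location of the binding deviation `r` at a price `c` not above the
equilibrium price. -/
lemma binding_deviation_foc {A s c r : ℝ} (hA : 99 / 100 ≤ A) (hA1 : A ≤ 1) (hs0 : 0 ≤ s)
    (hs : s ≤ 1 / 20000) (hc0 : 7 / 20 < c) (hc1 : c < 1 / 2) (hcs : c ^ 2 + 2 * c ≤ 1 - 2 * s)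
    (hr : r ∈ Set.Icc 0 A) (hbind : secondProfit s c r = c * (1 - c ^ 2) / 2)
    (hmax : ∀ t ∈ Set.Icc 0 A, secondProfit s c t ≤ secondProfit s c r) :
    1 / 2 + c - s - 2 * (1 + c) * r + 3 / 2 * r ^ 2 = 0 ∧ c ≤ r ∧ r < 9 / 20 := by
  have hg : 1 / 10 < c * (1 - c ^ 2) / 2 := by nlinarith
  have hr0 : 0 < r := by
    refine lt_of_le_of_ne hr.1 ?_
    rintro rfl
    simp only [secondProfit, zero_mul] at hbind
    linarith
  have hrA : r < A := by
    refine lt_of_le_of_ne hr.2 ?_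
    rintro rfl
    unfold secondProfit at hbind
    have h1 : c * (1 - r) + (1 - r) ^ 2 / 2 - s ≤ 1 / 100 := by nlinarith
    nlinarith
  have hder : HasDerivAt (secondProfit s c)
      (1 / 2 + c - s - 2 * (1 + c) * r + 3 / 2 * r ^ 2) r := by
    have h1 := (hasDerivAt_id r).const_sub 1
    have h2 := ((h1.const_mul c).add ((h1.pow 2).div_const 2)).sub_const s
    exact ((hasDerivAt_id r).mul h2).congr_deriv (by simp; ring)
  have hloc : IsLocalMax (secondProfit s c) r := by
    filter_upwards [Icc_mem_nhds hr0 hrA] with t ht using hmax t ht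
  have hfoc := hloc.hasDerivAt_eq_zero hder
  have hr1 : r < 9 / 20 := by
    by_contra! h
    nlinarith [mul_nonneg (sub_nonneg.2 h) (sub_nonneg.2 (hrA.le.trans hA1))]
  refine ⟨hfoc, ?_, hr1⟩
  by_contra! h
  nlinarith

/-- If both sellers can guarantee themselves the profit of the deviation `r`, and total demand is
`1 - a * b`, then the average price is at least `c`. -/
lemma le_average_of_sum_le {s c r a b : ℝ} (hc0 : 0 < c) (hr1 : r ≤ 1) (hcr : c ≤ r)
    (hbind : secondProfit s c r = c * (1 - c ^ 2) / 2)
    (hfoc : 1 / 2 + c - s - 2 * (1 + c) * r + 3 / 2 * r ^ 2 = 0)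
    (ha : 0 < a) (hb : 0 < b) (hab : a + b ≤ 1)
    (h : a * secondProfit s a r + b * secondProfit s b r ≤ a * b * (1 - a * b)) :
    c ≤ (a + b) / 2 := by
  obtain ⟨m, rfl⟩ : ∃ m, b = 2 * m - a := ⟨(a + b) / 2, by ring⟩
  have hm0 : 0 < m := by linarith
  have hm1 : m ≤ 1 / 2 := by linarith
  have hr0 : 0 < r := hc0.trans_le hcr
  by_contra! hlt
  have hlt : m < c := by linarith
  set k := r * (1 - r) with hk
  set L := r * ((1 - r) ^ 2 / 2 - s) with hL
  have hF : ∀ q, secondProfit s q r = k * q + L := fun q => by rw [secondProfit, hk, hL]; ring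
  simp only [hF] at h hbind
  have hk0 : 0 ≤ k := mul_nonneg hr0.le (by linarith)
  -- replacing both prices by their mean relaxes the inequality
  have hmid : m * (2 * k * m + 2 * L) ≤ m * (m * (1 - m ^ 2)) := by
    have h1 : 0 ≤ k * (a - m) ^ 2 := mul_nonneg hk0 (sq_nonneg _)
    have h2 : 0 ≤ (a - m) ^ 2 * (1 - m ^ 2 - a * (2 * m - a)) := by
      refine mul_nonneg (sq_nonneg _) ?_
      nlinarith [sq_nonneg (a - m)]
    nlinarith
  have hG := le_of_mul_le_mul_left hmid hm0
  -- the slope at `c` of the concave function `x * (1 - x ^ 2) - 2 * (k * x + L)` is nonnegative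
  have hslope : 0 ≤ c * (1 - 3 * c ^ 2 - 2 * k) := by
    have h1 : c * (1 - c ^ 2) = 2 * r ^ 2 * (1 + c - r) := by
      have : s = 1 / 2 + c - 2 * (1 + c) * r + 3 / 2 * r ^ 2 := by linarith
      rw [hk, hL, this] at hbind
      linarith
    have h2 : c * (1 - 3 * c ^ 2 - 2 * k) = 2 * (r - c) * (r * (1 - r) + c ^ 2 + c * r) := by
      rw [hk]; linear_combination h1
    rw [h2]
    have := sub_nonneg.2 hcr
    positivity
  have hslope' : 0 ≤ 1 - 3 * c ^ 2 - 2 * k := nonneg_of_mul_nonneg_right hslope hc0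
  have h3 : 0 < (c - m) * (1 - 2 * k - (m ^ 2 + m * c + c ^ 2)) := by
    refine mul_pos (by linarith) ?_
    nlinarith
  nlinarith

/-- A seller facing a price `b < c` prefers the deviation `r` to any price above `r + e`, even if
all consumers were to search. -/
lemma price_le_of_lt {s c r a b e : ℝ} (he0 : 0 ≤ e) (he1 : e ≤ 1 / 100) (hse : s = e ^ 2 / 2)
    (hc0 : 7 / 20 < c) (hc1 : c < 1 / 2) (hcr : c ≤ r) (hr1 : r < 9 / 20)
    (hfoc : 1 / 2 + c - s - 2 * (1 + c) * r + 3 / 2 * r ^ 2 = 0)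
    (hb0 : 0 < b) (hbc : b < c) (ha1 : a < 1)
    (h : secondProfit s b r ≤ a * (b * (1 - a) + (1 - a) ^ 2 / 2)) : a ≤ r + e := by
  by_contra! ha
  have hx : 0 < a - r := by linarith
  have hx2 : e ^ 2 ≤ (a - r) ^ 2 := by nlinarith
  have key : (a - r) ^ 2 * (1 + c - r - a / 2) - (c - b) * (a - r) * (a + r - 1) - a * s ≤ 0 := by
    unfold secondProfit at h
    have : s = 1 / 2 + c - 2 * (1 + c) * r + 3 / 2 * r ^ 2 := by linarith
    nlinarith
  rcases le_or_gt (a + r) 1 with hle | hgt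
  · have h1 : 0 ≤ (c - b) * (a - r) * (1 - (a + r)) :=
      mul_nonneg (mul_nonneg (by linarith) hx.le) (by linarith)
    have h2 : e ^ 2 * (a / 2) ≤ (a - r) ^ 2 * (a / 2) :=
      mul_le_mul_of_nonneg_right hx2 (by linarith)
    have h3 : 0 < (a - r) ^ 2 * (1 + c - r - a) := mul_pos (by positivity) (by linarith)
    rw [hse] at key
    linarith
  · have h1 : (c - b) * (a - r) * (a + r - 1) ≤ c * (a - r) * (a - r) := by
      have i1 : (c - b) * (a - r) ≤ c * (a - r) :=
        mul_le_mul_of_nonneg_right (by linarith) hx.le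
      exact mul_le_mul i1 (by linarith) (by linarith) (by positivity)
    have h2 : (1 / 10) ^ 2 ≤ (a - r) ^ 2 := by
      apply pow_le_pow_left₀ <;> linarith
    have h3 : 1 / 20 ≤ 1 - r - a / 2 := by linarith
    have h4 : (1 / 10) ^ 2 * (1 / 20) ≤ (a - r) ^ 2 * (1 - r - a / 2) :=
      mul_le_mul h2 h3 (by norm_num) (sq_nonneg _)
    have h5 : s ≤ 1 / 20000 := by
      have := pow_le_pow_left₀ he0 he1 2
      rw [hse]; linarith
    have h6 : a * s ≤ 1 * (1 / 20000) :=
      mul_le_mul ha1.le h5 (by rw [hse]; positivity) zero_le_one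
    linarith

section

variable {A s : ℝ} (hA : 99 / 100 ≤ A) (hA1 : A ≤ 1) (hs : expectedSurplus A = s)
include hA hA1 hs

/-- The equilibrium price of the market without contracts. -/
lemma exists_equilibrium : ∃ q ∈ diagonalPrices A s, q ^ 2 + 2 * q = 1 - 2 * s := by
  have hs1 := searchCost_le hA hA1 hs
  have hs0 : 0 ≤ s := hs ▸ expectedSurplus_nonneg A
  have hsq := Real.sq_sqrt (show 0 ≤ 2 - 2 * s by linarith)
  have h1 : 1 ≤ √(2 - 2 * s) := Real.one_le_sqrt.2 (by linarith)
  have h2 : √(2 - 2 * s) ≤ 2 := Real.sqrt_le_iff.2 ⟨by norm_num, by linarith⟩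
  have h : (√(2 - 2 * s) - 1) ^ 2 + 2 * (√(2 - 2 * s) - 1) = 1 - 2 * s := by linarith
  exact ⟨_, mem_diagonalPrices_of_equilibrium hA1 hs0 ⟨by linarith, by linarith⟩ h, h⟩

lemma le_equilibrium_of_isLeast {c : ℝ} (hc : IsLeast (diagonalPrices A s) c) :
    c ^ 2 + 2 * c ≤ 1 - 2 * s := by
  obtain ⟨q, hq, h⟩ := exists_equilibrium hA hA1 hs
  have := hc.2 hq
  have := hc.1.1.1
  nlinarith

/-- Every implementable contract yields at least the industry profit of the lowest diagonal price
`c`, and its prices are either both at least `c`, or moderate and at least `c` on average. -/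
lemma implementable_bounds {c a b α : ℝ} (hc : IsLeast (diagonalPrices A s) c)
    (h : (a, b, α) ∈ implementableContracts s) :
    c * (1 - c ^ 2) ≤ industryProfit s (a, b, α) ∧
      ((c ≤ a ∧ c ≤ b) ∨ (2 * c ≤ a + b ∧ a ≤ 1 / 2 ∧ b ≤ 1 / 2)) := by
  have hA0 : 0 ≤ A := by linarith
  have hs1 := searchCost_le hA hA1 hs
  have hs0 : 0 ≤ s := hs ▸ expectedSurplus_nonneg A
  have hse := searchCost_eq hA0 hA1 hs
  obtain ⟨hc0, hc1⟩ := bounds_of_mem_diagonalPrices hA hs1 hc.1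
  obtain ⟨r, hr, hbind, hmax⟩ := exists_binding_deviation hA0 hA1 (by linarith) hc
  obtain ⟨hfoc, hcr, hr1⟩ := binding_deviation_foc hA hA1 hs0 hs1 hc0 hc1
    (le_equilibrium_of_isLeast hA hA1 hs hc) hr hbind hmax
  have hprofit : ∀ {a b α : ℝ}, industryProfit s (a, b, α) =
      (α * (a * demandFirst s a b) + (1 - α) * (a * demandSecond s b a))
        + (α * (b * demandSecond s a b) + (1 - α) * (b * demandFirst s b a)) := rfl
  -- by symmetry, only the second seller may have a price below `c`
  have key : ∀ {a b α : ℝ}, (a, b, α) ∈ implementableContracts s → b < c →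
      c * (1 - c ^ 2) ≤ industryProfit s (a, b, α) ∧
        (2 * c ≤ a + b ∧ a ≤ 1 / 2 ∧ b ≤ 1 / 2) := by
    intro a b α h hbc
    have ha0 := pos_of_mem hA hA1 hs h
    have hb0 := pos_of_mem hA hA1 hs (swap_mem_implementableContracts h)
    have ha1 := lt_one_of_mem hA hA1 hs h
    obtain ⟨⟨h0, h1⟩, h2, h3⟩ := mem_implementableContracts.1 h
    have h2r := h2 r
    rw [mul_demandSecond_eq hA hA1 hs hb0.le (by linarith) hr.1 hr.2 (by linarith)] at h2r
    have har : a ≤ r + (1 - A) := by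
      rcases le_or_gt a (r + (1 - A)) with hle | hgt
      · exact hle
      refine price_le_of_lt (by linarith) (by linarith) hse hc0 hc1 hcr hr1 hfoc hb0 hbc ha1
        (h2r.trans ?_)
      rw [demandFirst_of_far hA0 hA1 hs ha0.le ha1.le hb0.le (by linarith) (by linarith)]
      have := mul_le_mul_of_nonneg_left (mul_le_mul_of_nonneg_left
        (demandSecond_le hA0 hA1 hs hb0.le (by linarith) ha0.le ha1.le) ha0.le) (sub_nonneg.2 h1)
      linarith
    have h3r := h3 r
    rw [mul_demandSecond_eq hA hA1 hs ha0.le ha1.le hr.1 hr.2 (by linarith)] at h3r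
    have d1 := demandFirst_add_demandSecond hA0 hA1 hs ha0.le ha1.le hb0.le
      (show b ≤ A by linarith)
    have d2 := demandFirst_add_demandSecond hA0 hA1 hs hb0.le (by linarith : b ≤ 1) ha0.le
      (show a ≤ A by linarith)
    have hsum : a * secondProfit s a r + b * secondProfit s b r ≤ a * b * (1 - a * b) := by
      have e1 := mul_le_mul_of_nonneg_left h2r hb0.le
      have e2 := mul_le_mul_of_nonneg_left h3r ha0.le
      have e3 : demandFirst s a b = 1 - a * b - demandSecond s a b := by linarith
      have e4 : demandFirst s b a = 1 - b * a - demandSecond s b a := by linarith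
      rw [e3] at e1
      rw [e4] at e2
      linarith
    have hm := le_average_of_sum_le (by linarith) (by linarith) hcr hbind hfoc ha0 hb0
      (by linarith) hsum
    refine ⟨?_, by linarith, by linarith, by linarith⟩
    have hmono := secondProfit_mono (s := s) hr.1 (hr.2.trans hA1) hm
    have hmid : secondProfit s ((a + b) / 2) r = (secondProfit s a r + secondProfit s b r) / 2 := by
      unfold secondProfit; ring
    simp only at hmono
    rw [hprofit]
    linarith
  rcases lt_or_ge b c with hbc | hbc
  · exact ⟨(key h hbc).1, Or.inr (key h hbc).2⟩
  rcases lt_or_ge a c with hac | hac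
  · obtain ⟨h1, h2, h3, h4⟩ := key (swap_mem_implementableContracts h) hac
    refine ⟨h1.trans (le_of_eq ?_), Or.inr ⟨by linarith, h4, h3⟩⟩
    rw [hprofit, hprofit]; ring
  · refine ⟨?_, Or.inl ⟨hac, hbc⟩⟩
    obtain ⟨-, h2, h3⟩ := mem_implementableContracts.1 h
    have e := mul_demandSecond_eq hA hA1 hs (p := c) (by linarith) (by linarith) hr.1 hr.2
      (by linarith)
    have m1 := mul_le_mul_of_nonneg_left (demandSecond_mono s r hac) hr.1
    have m2 := mul_le_mul_of_nonneg_left (demandSecond_mono s r hbc) hr.1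
    simp only at m1 m2
    rw [hprofit]
    linarith [h2 r, h3 r]

/-! ### Welfare -/

lemma orderedWelfare_of_near {p q : ℝ} (hp0 : 0 ≤ p) (hp1 : p ≤ 1) (hq0 : 0 ≤ q) (hqA : q ≤ A)
    (h : p - (1 - A) ≤ q) : orderedWelfare s p q =
      2 / 3 - s - (p ^ 3 + 3 * p * q ^ 2) / 6 - (q - p) ^ 2 / 2 * (A - q)
        - (q - p + (1 - A)) ^ 3 / 6 + s * (q - p + (1 - A)) := by
  rw [orderedWelfare_eq (by linarith) hA1 hs hp0 hp1 hq0 hqA (min_eq_right (by linarith))]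
  ring

lemma orderedWelfare_of_far {p q : ℝ} (hp0 : 0 ≤ p) (hp1 : p ≤ 1) (hq0 : 0 ≤ q) (hqA : q ≤ A)
    (h : q ≤ p - (1 - A)) : orderedWelfare s p q =
      2 / 3 - s - (p ^ 3 + 3 * p * q ^ 2) / 6 - (q - p) ^ 2 / 2 * (1 - p) := by
  rw [orderedWelfare_eq (by linarith) hA1 hs hp0 hp1 hq0 hqA (min_eq_left (by linarith))]
  ring

lemma orderedWelfare_self {c : ℝ} (hc0 : 0 ≤ c) (hcA : c ≤ A) :
    orderedWelfare s c c = 2 / 3 - s - 2 / 3 * c ^ 3 + (1 - A) ^ 3 / 3 := by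
  rw [orderedWelfare_of_near hA hA1 hs hc0 (hcA.trans hA1) hc0 hcA (by linarith),
    searchCost_eq (by linarith) hA1 hs]
  ring

/-- Welfare is bounded by that of unbiased choices and searches, given who is excluded from buying;
the last term is the loss from the bias that a price difference creates. -/
lemma orderedWelfare_le {p q : ℝ} (hp0 : 0 ≤ p) (hp1 : p ≤ 1) (hq0 : 0 ≤ q) (hqA : q ≤ A) :
    orderedWelfare s p q ≤ 2 / 3 - s - (p ^ 3 + 3 * p * q ^ 2) / 6 + (1 - A) ^ 3 / 3
      - (if p ≤ q then (q - p) ^ 2 / 2 * (A - q) else 0) := by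
  have hse := searchCost_eq (by linarith) hA1 hs
  have he : 0 ≤ 1 - A := by linarith
  rcases le_total (p - (1 - A)) q with h | h
  · rw [orderedWelfare_of_near hA hA1 hs hp0 hp1 hq0 hqA h]
    -- `s * y - y ^ 3 / 6` is largest at `y = 1 - A`
    have h1 : s * (q - p + (1 - A)) - (q - p + (1 - A)) ^ 3 / 6 ≤ (1 - A) ^ 3 / 3 := by
      have h2 : 0 ≤ (q - p) ^ 2 * (q - p + (1 - A) + 2 * (1 - A)) :=
        mul_nonneg (sq_nonneg _) (by linarith)
      rw [hse]; nlinarith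
    have h3 : 0 ≤ (q - p) ^ 2 / 2 * (A - q) := mul_nonneg (by positivity) (by linarith)
    split_ifs <;> linarith
  · rw [orderedWelfare_of_far hA hA1 hs hp0 hp1 hq0 hqA h]
    have h1 : 0 ≤ (q - p) ^ 2 / 2 * (1 - p) := mul_nonneg (by positivity) (by linarith)
    have h2 : 0 ≤ (1 - A) ^ 3 / 3 := by positivity
    split_ifs with h4
    · have h5 : q = p := by linarith
      subst h5
      simp only [sub_self]
      linarith
    · linarith

lemma orderedWelfare_le_self {c p q : ℝ} (hc0 : 7 / 20 < c) (hc1 : c < 1 / 2) (hp0 : 0 < p)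
    (hp1 : p < 1) (hq0 : 0 < q) (hq1 : q < 1)
    (h : (c ≤ p ∧ c ≤ q) ∨ (2 * c ≤ p + q ∧ p ≤ 1 / 2 ∧ q ≤ 1 / 2)) :
    orderedWelfare s p q ≤ orderedWelfare s c c := by
  have hA0 : 0 ≤ A := by linarith
  have he : 0 ≤ (1 - A) ^ 3 := pow_nonneg (by linarith) _
  have hs1 := searchCost_le hA hA1 hs
  rw [orderedWelfare_self hA hA1 hs (by linarith) (by linarith)]
  rcases le_or_gt q A with hqA | hqA
  · have hW := orderedWelfare_le hA hA1 hs hp0.le hp1.le hq0.le hqA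
    rcases h with ⟨hcp, hcq⟩ | ⟨hsum, hp2, hq2⟩
    · have h1 : 0 ≤ if p ≤ q then (q - p) ^ 2 / 2 * (A - q) else 0 := by
        split_ifs
        · exact mul_nonneg (by positivity) (by linarith)
        · exact le_rfl
      have h2 : c ^ 3 ≤ p ^ 3 := pow_le_pow_left₀ (by linarith) hcp 3
      have h3 : c * c ^ 2 ≤ p * q ^ 2 :=
        mul_le_mul hcp (pow_le_pow_left₀ (by linarith) hcq 2) (by positivity) hp0.le
      nlinarith
    · -- with `m` the mean price, `p ^ 3 + 3 * p * q ^ 2 = 4 * m ^ 3 + (p - q) ^ 3 / 2`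
      have h1 : c ^ 3 ≤ ((p + q) / 2) ^ 3 := pow_le_pow_left₀ (by linarith) (by linarith) 3
      have h2 : p ^ 3 + 3 * p * q ^ 2 = 4 * ((p + q) / 2) ^ 3 + (p - q) ^ 3 / 2 := by ring
      rw [h2] at hW
      split_ifs at hW with hpq
      · have h3 : 0 ≤ (q - p) ^ 2 * ((A - q) / 2 - (q - p) / 12) :=
          mul_nonneg (sq_nonneg _) (by linarith)
        nlinarith
      · have h3 : 0 ≤ (p - q) ^ 3 := pow_nonneg (by linarith) _
        linarith
  · rw [orderedWelfare_of_gt hA0 hA1 hs hp0.le hp1.le hqA hq1.le]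
    have hcp : c ≤ p := by
      rcases h with h | h
      · exact h.1
      · linarith
    have h1 : c ^ 2 ≤ p ^ 2 := pow_le_pow_left₀ (by linarith) hcp 2
    nlinarith

end

/-! ### The boundary of the implementable set and the extremal contract -/

lemma consumerSurplus_eq (s : ℝ) (c : Contract) :
    consumerSurplus s c = socialWelfare s c - industryProfit s c := by
  obtain ⟨a, b, α⟩ := c
  simp only [consumerSurplus, socialWelfare, industryProfit, profitOne, profitTwo,
    orderedSurplus_eq]
  ring

section

variable {A s : ℝ} (hA : 99 / 100 ≤ A) (hA1 : A ≤ 1) (hs : expectedSurplus A = s)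
include hA hA1 hs

lemma setOf_diagonal_mem_implementablePrices :
    {p : ℝ | (p, p) ∈ implementablePrices s} = diagonalPrices A s := by
  ext p
  exact ⟨fun h => mem_diagonalPrices_of_mem_closure hA hA1 hs (subset_closure h),
    fun h => ⟨_, symmetric_mem_implementableContracts hA hA1 hs h⟩⟩

lemma setOf_diagonal_mem_frontier {c d : ℝ} (hc : IsLeast (diagonalPrices A s) c)
    (hd : IsGreatest (diagonalPrices A s) d) :
    {p : ℝ | (p, p) ∈ frontier (implementablePrices s)} = {c, d} := by
  have hset : ∀ p, (p, p) ∈ implementablePrices s ↔ p ∈ diagonalPrices A s := fun p =>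
    Set.ext_iff.1 (setOf_diagonal_mem_implementablePrices hA hA1 hs) p
  -- near an interior diagonal point, all diagonal points are implementable
  have hnhds : ∀ p, (p, p) ∈ interior (implementablePrices s) →
      ∀ᶠ x in nhds p, x ∈ diagonalPrices A s := fun p hp => by
    have hcont : ContinuousAt (fun x : ℝ => (x, x)) p := by fun_prop
    exact (hcont.eventually (mem_interior_iff_mem_nhds.1 hp)).mono fun x hx => (hset x).1 hx
  ext p
  simp only [Set.mem_ofPred_eq, Set.mem_insert_iff, Set.mem_singleton_iff]
  constructor
  · rintro ⟨hcl, hint⟩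
    have hp := mem_diagonalPrices_of_mem_closure hA hA1 hs hcl
    by_contra! hne
    obtain ⟨κ, hκ, h⟩ := exists_slack hc.1 hd.1 (lt_of_le_of_ne (hc.2 hp) hne.1.symm)
      (lt_of_le_of_ne (hd.2 hp) hne.2)
    exact hint (mem_interior_of_slack hA hA1 hs hp hκ h)
  · rintro (rfl | rfl)
    · refine ⟨subset_closure ((hset p).2 hc.1), fun hint => ?_⟩
      obtain ⟨x, hx, hxp⟩ := (((hnhds p hint).filter_mono nhdsWithin_le_nhds).and
        (self_mem_nhdsWithin (s := Set.Iio p))).exists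
      exact absurd (hc.2 hx) (not_le.2 hxp)
    · refine ⟨subset_closure ((hset p).2 hd.1), fun hint => ?_⟩
      obtain ⟨x, hx, hxp⟩ := (((hnhds p hint).filter_mono nhdsWithin_le_nhds).and
        (self_mem_nhdsWithin (s := Set.Ioi p))).exists
      exact absurd (hd.2 hx) (not_le.2 hxp)

lemma industryProfit_self {c : ℝ} (hc0 : 0 ≤ c) (hcA : c ≤ A) :
    industryProfit s (c, c, 1 / 2) = c * (1 - c ^ 2) := by
  have h := demandFirst_add_demandSecond (by linarith) hA1 hs hc0 (hcA.trans hA1) hc0 hcA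
  simp only [industryProfit, profitOne, profitTwo]
  linear_combination c * h

end

/-- For `A` (the reservation value `V(A) = s`) close enough to `1`: the boundary of `P` meets the
diagonal in `(pLow, pLow)` and `(pHigh, pHigh)`, and the contract `(pLow, pLow, 1/2)` is
implementable, minimizes industry profit and maximizes social welfare and consumer surplus. -/
theorem proposition6 :
    ∃ A₀ : ℝ, A₀ < 1 ∧ ∀ A s : ℝ, A₀ ≤ A → A ≤ 1 → expectedSurplus A = s →
      ∃ pLow pHigh : ℝ, pLow ≤ pHigh ∧
        {p : ℝ | (p, p) ∈ frontier (implementablePrices s)} = {pLow, pHigh} ∧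
        IsLeast {p : ℝ | (p, p) ∈ implementablePrices s} pLow ∧
        (pLow, pLow, (1 / 2 : ℝ)) ∈ implementableContracts s ∧
        IsMinOn (industryProfit s) (implementableContracts s) (pLow, pLow, (1 / 2 : ℝ)) ∧
        IsMaxOn (socialWelfare s) (implementableContracts s) (pLow, pLow, (1 / 2 : ℝ)) ∧
        IsMaxOn (consumerSurplus s) (implementableContracts s) (pLow, pLow, (1 / 2 : ℝ)) := by
  refine ⟨99 / 100, by norm_num, fun A s hA hA1 hs => ?_⟩
  obtain ⟨c, hc⟩ := (isCompact_diagonalPrices A s).exists_isLeast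
    ((exists_equilibrium hA hA1 hs).imp fun _ h => h.1)
  obtain ⟨d, hd⟩ := (isCompact_diagonalPrices A s).exists_isGreatest
    ((exists_equilibrium hA hA1 hs).imp fun _ h => h.1)
  obtain ⟨hc0, hc1⟩ := bounds_of_mem_diagonalPrices hA (searchCost_le hA hA1 hs) hc.1
  have hmin : ∀ x ∈ implementableContracts s,
      industryProfit s (c, c, 1 / 2) ≤ industryProfit s x := by
    rintro ⟨a, b, α⟩ h
    rw [industryProfit_self hA hA1 hs (by linarith) (by linarith)]
    exact (implementable_bounds hA hA1 hs hc h).1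
  have hmax : ∀ x ∈ implementableContracts s,
      socialWelfare s x ≤ socialWelfare s (c, c, 1 / 2) := by
    rintro ⟨a, b, α⟩ h
    have h' := swap_mem_implementableContracts h
    have ha0 := pos_of_mem hA hA1 hs h
    have ha1 := lt_one_of_mem hA hA1 hs h
    have hb0 := pos_of_mem hA hA1 hs h'
    have hb1 := lt_one_of_mem hA hA1 hs h'
    have h1 := orderedWelfare_le_self hA hA1 hs hc0 hc1 ha0 ha1 hb0 hb1
      (implementable_bounds hA hA1 hs hc h).2
    have h2 := orderedWelfare_le_self hA hA1 hs hc0 hc1 hb0 hb1 ha0 ha1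
      (implementable_bounds hA hA1 hs hc h').2
    have hα : α ∈ Set.Icc (0 : ℝ) 1 := (mem_implementableContracts.1 h).1
    have e1 := mul_le_mul_of_nonneg_left h1 hα.1
    have e2 := mul_le_mul_of_nonneg_left h2 (sub_nonneg.2 hα.2)
    simp only [socialWelfare]
    linarith
  refine ⟨c, d, hd.2 hc.1, setOf_diagonal_mem_frontier hA hA1 hs hc hd, ?_,
    symmetric_mem_implementableContracts hA hA1 hs hc.1, hmin, hmax, fun x hx => ?_⟩
  · rw [setOf_diagonal_mem_implementablePrices hA hA1 hs]
    exact hc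
  · simp only [Set.mem_ofPred_eq, consumerSurplus_eq]
    linarith [hmin x hx, hmax x hx]
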